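/- Let $\mathbb K=\mathbb R$ or $\mathbb C$. For $0\le d\le 10$ let $\mathfrak Q_{10-d,d}(0,\dots,0)$ be the quotient of the free Lie algebra over $\mathbb K$ on ten generators, listed in the order $x_0,x_1,\dots,x_8,x_{10}$ and also written $y_1,\dots,y_{10}$, by the ideal generated by the ten elements $\sum_{i=1}^{10-d}[y_i,[y_i,y_j]]-\sum_{i=11-d}^{10}[y_i,[y_i,y_j]]$, $j=1,\dots,10$. Let $\mathfrak g(E_9)$ be the Kac–Moody algebra over $\mathbb K$ of type $E_9$ (the untwisted affine extension of $E_8$) with simple roots $\alpha_0,\alpha_1,\dots,\alpha_8$, where $\alpha_1,\dots,\alpha_8$ are the simple roots of $E_8$, with Chevalley generators $e_i,f_i$ and root system $\Delta(E_9)$, and let $\mathfrak g'(E_9)=[\mathfrak g(E_9),\mathfrak g(E_9)]$. Let $\theta$ be the highest root of $E_8$ and $\delta=\alpha_0+\theta$. Let $\gamma=n\delta+\beta$ be a real root of $E_9$, with $n\in\mathbb Z$ and $\beta\in\Delta(E_8)\setminus\{-\theta,\alpha_1,\dots,\alpha_8\}$, and let $0\ne e_\gamma\in\mathfrak g(E_9)_\gamma$.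 Then: 1. For $i=0,\dots,8$, neither $2\gamma-\alpha_i$ nor $\gamma-2\alpha_i$ is a root of $E_9$, and $[y,[y,z]]=0$ for all $y,z\in\{e_\gamma,f_0,f_1,\dots,f_8\}$. 2. For every $d$ with $0\le d\le 10$, the map $x_0\mapsto f_0,\ \dots,\ x_8\mapsto f_8,\ x_{10}\mapsto e_\gamma$ extends to a homomorphism of Lie algebras $\mathfrak Q_{10-d,d}(0,\dots,0)\to\mathfrak g'(E_9)$. 3. If moreover $\gamma$ is a positive root with maximal support, i.e. $\gamma=\sum_{i=0}^8k_i\alpha_i$ with all $k_i>0$, then the elements $e_\gamma,f_0,f_1,\dots,f_8$ generate $\mathfrak g'(E_9)$, and the homomorphism in 2 is an epimorphism for every $d$. -/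

import Mathlib

/-! ### Quantum minimal surface algebras -/

/-- The sign of the `i`-th generator (counted from `0`) in signature `(n - m, m)`: the first `n - m`
generators carry the sign `+1`, the last `m` the sign `-1`. -/
def qmsaSign (n m : ℕ) (i : Fin n) : ℤ :=
  if (i : ℕ) < n - m then 1 else -1

/-- The terms `∑ i, ± [x_i, [x_i, x_j]] - μ_j x_j`, `j = 1, …, n`, of the free Lie algebra. -/
noncomputable def qmsaRelation (K : Type*) [CommRing K] (n m : ℕ) (μ : Fin n → K) (j : Fin n) :
    FreeLieAlgebra K (Fin n) :=
  (∑ i : Fin n, qmsaSign n m i •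
      ⁅FreeLieAlgebra.of K i, ⁅FreeLieAlgebra.of K i, FreeLieAlgebra.of K j⁆⁆)
    - μ j • FreeLieAlgebra.of K j

/-- The ideal of the free Lie algebra that is generated by the relations. -/
noncomputable def qmsaIdeal (K : Type*) [CommRing K] (n m : ℕ) (μ : Fin n → K) :
    LieIdeal K (FreeLieAlgebra K (Fin n)) :=
  LieSubmodule.lieSpan K (FreeLieAlgebra K (Fin n)) (Set.range (qmsaRelation K n m μ))

/-- The quantum minimal surface algebra of rank `n`, signature `(n - m, m)` (for `m ≤ n`) and
spectrum `μ`. -/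
abbrev QMSA (K : Type*) [CommRing K] (n m : ℕ) (μ : Fin n → K) : Type _ :=
  FreeLieAlgebra K (Fin n) ⧸ qmsaIdeal K n m μ

/-- The generators of the quantum minimal surface algebra. -/
noncomputable def QMSA.gen (K : Type*) [CommRing K] (n m : ℕ) (μ : Fin n → K) (j : Fin n) :
    QMSA K n m μ :=
  LieSubmodule.Quotient.mk (N := qmsaIdeal K n m μ) (FreeLieAlgebra.of K j)

/-! ### Kac-Moody algebras -/

/-- A realization `(H, Π, Π^∨)` over the field `K` of an integral matrix `A`: linearly independent
simple roots in the dual of `H` and linearly independent simple coroots in `H` that are paired by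
`A`, where `dim H = 2 n - rank A`. -/
structure Realization (K : Type*) [Field K] {ι : Type*} [Fintype ι] (A : Matrix ι ι ℤ)
    (H : Type*) [AddCommGroup H] [Module K H] where
  /-- The simple roots. -/
  root : ι → Module.Dual K H
  /-- The simple coroots. -/
  coroot : ι → H
  root_coroot : ∀ i j, root j (coroot i) = (A i j : K)
  linearIndependent_root : LinearIndependent K root
  linearIndependent_coroot : LinearIndependent K coroot
  finiteDimensional : FiniteDimensional K H
  finrank_add_rank :
    Module.finrank K H + (A.map (Int.cast : ℤ → K)).rank = 2 * Fintype.card ι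

/-- The generators of a Kac-Moody algebra: the elements of the Cartan subalgebra `H` and the
elements `e_i`, `f_i`. -/
inductive KMGenerator (H ι : Type*)
  | h : H → KMGenerator H ι
  | e : ι → KMGenerator H ι
  | f : ι → KMGenerator H ι

/-- The free Lie algebra on the generators of a Kac-Moody algebra. -/
abbrev KMFree (K : Type*) [CommRing K] (H ι : Type*) : Type _ :=
  FreeLieAlgebra K (KMGenerator H ι)

namespace KMFree

variable (K : Type*) [CommRing K] {H ι : Type*}

/-- The generator of the free Lie algebra that belongs to `x : H`. -/
noncomputable def h (x : H) : KMFree K H ι := FreeLieAlgebra.of K (KMGenerator.h x)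

/-- The generator `e_i` of the free Lie algebra. -/
noncomputable def e (i : ι) : KMFree K H ι := FreeLieAlgebra.of K (KMGenerator.e i)

/-- The generator `f_i` of the free Lie algebra. -/
noncomputable def f (i : ι) : KMFree K H ι := FreeLieAlgebra.of K (KMGenerator.f i)

end KMFree

namespace Realization

variable {K : Type*} [Field K] {ι : Type*} [Fintype ι] {A : Matrix ι ι ℤ}
  {H : Type*} [AddCommGroup H] [Module K H]

open KMFree in
/-- The elements of the free Lie algebra that are set to zero in the Kac-Moody algebra. The first
two families say that `H` is embedded linearly, the last two are the Serre relations. -/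
inductive IsRelator (R : Realization K A H) : KMFree K H ι → Prop
  | add (x y : H) : IsRelator R (h K (x + y) - (h K x + h K y))
  | smul (c : K) (x : H) : IsRelator R (h K (c • x) - c • h K x)
  | hh (x y : H) : IsRelator R ⁅(h K x : KMFree K H ι), (h K y : KMFree K H ι)⁆
  | he (x : H) (i : ι) : IsRelator R (⁅(h K x : KMFree K H ι), e K i⁆ - R.root i x • e K i)
  | hf (x : H) (i : ι) : IsRelator R (⁅(h K x : KMFree K H ι), f K i⁆ + R.root i x • f K i)
  | ef_same (i : ι) : IsRelator R (⁅(e K i : KMFree K H ι), f K i⁆ - h K (R.coroot i))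
  | ef_ne (i j : ι) (hij : i ≠ j) : IsRelator R ⁅(e K i : KMFree K H ι), (f K j : KMFree K H ι)⁆
  | serre_e (i j : ι) (hij : i ≠ j) : IsRelator R
      ((LieAlgebra.ad K (KMFree K H ι) (e K i) ^ (1 - A i j).toNat) (e K j))
  | serre_f (i j : ι) (hij : i ≠ j) : IsRelator R
      ((LieAlgebra.ad K (KMFree K H ι) (f K i) ^ (1 - A i j).toNat) (f K j))

/-- The ideal generated by the defining relations. -/
noncomputable def ideal (R : Realization K A H) :
    LieIdeal K (KMFree K H ι) :=
  LieSubmodule.lieSpan K (KMFree K H ι) {x | R.IsRelator x}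

/-- The Kac-Moody algebra `𝔤(A)` of a (symmetrizable) generalized Cartan matrix `A`, with Cartan
subalgebra given by the realization. -/
abbrev KacMoody (R : Realization K A H) : Type _ :=
  KMFree K H ι ⧸ R.ideal

/-- The elements of the Cartan subalgebra in the Kac-Moody algebra. -/
noncomputable def h (R : Realization K A H) (x : H) : R.KacMoody :=
  LieSubmodule.Quotient.mk (N := R.ideal) (KMFree.h K x)

/-- The Chevalley generators `f_i`. -/
noncomputable def f (R : Realization K A H) (i : ι) : R.KacMoody :=
  LieSubmodule.Quotient.mk (N := R.ideal) (KMFree.f K i)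

/-- The derived algebra `𝔤'(A) = [𝔤(A), 𝔤(A)]`. -/
noncomputable def derived (R : Realization K A H) : LieSubalgebra K R.KacMoody :=
  LieIdeal.toLieSubalgebra K R.KacMoody
    ⁅(⊤ : LieIdeal K R.KacMoody), (⊤ : LieIdeal K R.KacMoody)⁆

/-- The linear form `∑ i, k_i α_i` on `H` with coordinates `k` in the root lattice. -/
noncomputable def weight (R : Realization K A H) (k : ι → ℤ) : Module.Dual K H :=
  ∑ i, k i • R.root i

/-- The root space `𝔤(A)_α`, for `α = ∑ i, k_i α_i`. -/
noncomputable def rootSpace (R : Realization K A H) (k : ι → ℤ) : Submodule K R.KacMoody where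
  carrier := {x | ∀ y : H, ⁅R.h y, x⁆ = R.weight k y • x}
  add_mem' := fun {a b} ha hb y => by rw [lie_add, ha y, hb y, smul_add]
  zero_mem' := fun y => by rw [lie_zero, smul_zero]
  smul_mem' := fun c x hx y => by rw [lie_smul, hx y, smul_comm]

/-- The roots `Δ(A)`, in coordinates with respect to the simple roots. -/
def roots (R : Realization K A H) : Set (ι → ℤ) :=
  {k | k ≠ 0 ∧ R.rootSpace k ≠ ⊥}

end Realization

/-- The real roots `Δ^re(A) = W · {α_1, …, α_n}`, in coordinates with respect to the simple roots:
the smallest set that contains the simple roots and is stable under the simple reflections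
`r_i(λ) = λ - ⟨λ, α_i^∨⟩ α_i`, which generate the Weyl group `W`. -/
inductive IsRealRoot {ι : Type*} [Fintype ι] [DecidableEq ι] (A : Matrix ι ι ℤ) : (ι → ℤ) → Prop
  | simple (i : ι) : IsRealRoot A (Pi.single i 1)
  | reflect (i : ι) (k : ι → ℤ) (hk : IsRealRoot A k) :
      IsRealRoot A (k - (∑ j, A i j * k j) • Pi.single i 1)

/-! ### The types `E₈` and `E₉` -/

/-- The coefficients of the highest root `θ` of `E₈` (Bourbaki labelling, as in
`CartanMatrix.E₈`). -/
def thetaE8 : Fin 8 → ℤ := ![2, 3, 4, 6, 5, 4, 3, 2]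

/-- The generalized Cartan matrix of `E₉`, the affine extension of `E₈`. The index `0` is the affine
node, which is joined to the node `8`; the indices `1, …, 8` are the nodes of `E₈`. -/
def cartanE9 : Matrix (Fin 9) (Fin 9) ℤ :=
  !![ 2,  0,  0,  0,  0,  0,  0,  0, -1;
      0,  2,  0, -1,  0,  0,  0,  0,  0;
      0,  0,  2,  0, -1,  0,  0,  0,  0;
      0, -1,  0,  2, -1,  0,  0,  0,  0;
      0,  0, -1, -1,  2, -1,  0,  0,  0;
      0,  0,  0,  0, -1,  2, -1,  0,  0;
      0,  0,  0,  0,  0, -1,  2, -1,  0;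
      0,  0,  0,  0,  0,  0, -1,  2, -1;
     -1,  0,  0,  0,  0,  0,  0, -1,  2]

/-- The root lattice of `E₈` inside that of `E₉`. -/
def embedE8 (β : Fin 8 → ℤ) : Fin 9 → ℤ := Fin.cons 0 β

/-- The null root `δ = α_0 + θ` of `E₉`. -/
def deltaE9 : Fin 9 → ℤ := Pi.single 0 1 + embedE8 thetaE8

/-! Write $(\cdot,\cdot)$ for the form of the Cartan matrix and $q(k)=(k,k)$ (`quadForm`). Every
root has $q\le 2$ (`quadForm_le_two`): a root with $q>2$ could be moved along a string in a simple
direction to a root of smaller absolute height without decreasing $q$. This uses only the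
presentation: the words in the $e_i$, the words in the $f_i$ and the Cartan elements span, so roots
are sign-coherent, and the Serre relations make $e_i$ and $f_i$ locally nilpotent.

A real root has $q(\gamma)=2$, so $2\gamma-\alpha_i$ and $\gamma-2\alpha_i$ both have norm
$10-4(\gamma,\alpha_i)$. On $E_9$ the form is positive semidefinite with radical $\mathbb Z\delta$.
Hence $(\gamma,\alpha_i)\le 2$, with equality only for $\gamma\in\alpha_i+\mathbb Z\delta$; as
$\alpha_0=\delta-\theta$, this is exactly what the conditions on $\beta$ exclude. So the norm is at
least $6$ and the double brackets involving $e_\gamma$ vanish. Those among the $f_i$ vanish by the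
Serre relations. Each summand of each defining relation is then zero, whatever its sign, which gives
the homomorphism.

For generation it suffices to reach every $e_i$ (`e_mem_of_rootVector_mem`). Applying the $f_j$, the
root vector is reflected down to smaller height with its $i$-th coefficient kept positive. This
descent stops only at $\alpha_i$, whose root space is spanned by $e_i$, or at $\alpha_0+\delta$ for
$i=0$, where a detour through the root space of $\delta$ continues it. -/

/-! ### Weight decompositions -/

/-- If a family of vectors, each in a member of an independent family of submodules, spans the whole
module, then each member is spanned by those vectors that it contains. -/
theorem iSupIndep.eq_span_inter {K M κ : Type*} [Ring K] [AddCommGroup M] [Module K M]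
    {V : κ → Submodule K M} (hV : iSupIndep V) {G : Set M} (hG : Submodule.span K G = ⊤)
    (hGV : ∀ z ∈ G, ∃ k, z ∈ V k) (k : κ) : V k = Submodule.span K (G ∩ V k) := by
  refine le_antisymm (fun x hx => ?_) (Submodule.span_le.2 Set.inter_subset_right)
  have hsup : Submodule.span K (G ∩ V k) ⊔ ⨆ (j) (_ : j ≠ k), V j = ⊤ := by
    rw [eq_top_iff, ← hG, Submodule.span_le]
    intro z hz
    obtain ⟨j, hj⟩ := hGV z hz
    by_cases hjk : j = k
    · subst hjk
      exact Submodule.mem_sup_left (Submodule.subset_span ⟨hz, hj⟩)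
    · exact Submodule.mem_sup_right (Submodule.mem_iSup_of_mem j (Submodule.mem_iSup_of_mem hjk hj))
  obtain ⟨w, hw, u, hu, rfl⟩ := Submodule.mem_sup.1 (hsup ▸ Submodule.mem_top : x ∈ _)
  have hw' : w ∈ V k := (Submodule.span_le.2 Set.inter_subset_right) hw
  have hu' : u ∈ V k := by simpa using (V k).sub_mem hx hw'
  have hu0 : u = 0 := (Submodule.disjoint_def.1 (hV k)) u hu' hu
  simpa [hu0] using hw

/-! ### Iterated brackets -/

/-- The iterated brackets `[x_i, [x_j, … [x_k, x_l]]]`, with their degrees. -/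
inductive IsWord {ι L : Type*} [DecidableEq ι] [LieRing L] (x : ι → L) : (ι → ℤ) → L → Prop
  | single (i : ι) : IsWord x (Pi.single i 1) (x i)
  | cons (i : ι) (k : ι → ℤ) (w : L) (hw : IsWord x k w) :
      IsWord x (Pi.single i 1 + k) ⁅x i, w⁆

namespace IsWord

variable {K ι L : Type*} [DecidableEq ι] [LieRing L] {x : ι → L} {k : ι → ℤ} {w : L}

theorem pos (hw : IsWord x k w) : 0 < k := by
  have h (i : ι) : (0 : ι → ℤ) < Pi.single i 1 := by simp
  induction hw with
  | single i => exact h i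
  | cons i k w _ ih => exact add_pos (h i) ih

/-- A longer word in the single letter $x_i$ has $[x_i,x_i]=0$ inside. Degrees are nonnegative, so
no cancellation can hide another letter. -/
theorem of_support_subset (hw : IsWord x k w) {i : ι} (hk : ∀ j ≠ i, k j = 0) :
    (k i = 1 ∧ w = x i) ∨ w = 0 := by
  induction hw with
  | single j =>
    by_cases hj : j = i
    · subst hj; simp
    · simpa using hk j hj
  | cons j k w hw ih =>
    have hk0 : ∀ l, 0 ≤ k l := fun l => hw.pos.le l
    have hj : j = i := by
      by_contra hj
      have := hk j hj
      have := hk0 j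
      simp at *
      omega
    subst hj
    rcases ih (fun l hl => by simpa [hl] using hk l hl) with ⟨-, rfl⟩ | rfl <;> simp

variable [Field K] [LieAlgebra K L]

/-- If the range of `h : H → L` acts diagonally on the words in `y` and contains the brackets
`[a, y j]`, then `ad a` maps words in `y` to combinations of such words and elements of the
range. -/
theorem lie_mem {H : Type*} [AddCommGroup H] [Module K H] {h : H →ₗ[K] L} {y : ι → L}
    {a : L} (hx : ∀ j, ⁅a, y j⁆ ∈ LinearMap.range h)
    (hy : ∀ t k w, IsWord y k w → ⁅h t, w⁆ ∈ Submodule.span K {w}) (hw : IsWord y k w) :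
    ⁅a, w⁆ ∈ Submodule.span K {w | ∃ k, IsWord y k w} ⊔ LinearMap.range h := by
  induction hw with
  | single j => exact Submodule.mem_sup_right (hx j)
  | cons j k w hw ih =>
    rw [leibniz_lie]
    refine add_mem ?_ ?_
    · obtain ⟨t, ht⟩ := hx j
      rw [← ht]
      refine Submodule.mem_sup_left (Submodule.span_mono ?_ (hy t k w hw))
      rintro _ rfl
      exact ⟨k, hw⟩
    · obtain ⟨u, hu, _, ⟨t, rfl⟩, huv⟩ := Submodule.mem_sup.1 ih
      rw [← huv, lie_add]
      refine Submodule.mem_sup_left (add_mem ?_ ?_)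
      · clear huv ih
        induction hu using Submodule.span_induction with
        | mem z hz =>
          obtain ⟨l, hz⟩ := hz
          exact Submodule.subset_span ⟨_, hz.cons j l z⟩
        | zero => simp
        | add a b _ _ ha hb => rw [lie_add]; exact add_mem ha hb
        | smul c a _ ha => rw [lie_smul]; exact Submodule.smul_mem _ c ha
      · rw [← lie_skew, neg_mem_iff]
        refine Submodule.span_mono ?_ (hy t _ _ (.single j))
        rintro _ rfl
        exact ⟨_, .single j⟩

end IsWord

/-! ### Relations and generation -/

namespace Realization

variable {K : Type*} [Field K] {ι : Type*} [Fintype ι] {A : Matrix ι ι ℤ}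
  {H : Type*} [AddCommGroup H] [Module K H] (R : Realization K A H)

/-- The Chevalley generators `e_i`. -/
noncomputable def e (i : ι) : R.KacMoody :=
  LieSubmodule.Quotient.mk (N := R.ideal) (KMFree.e K i)

/-- The projection of the free Lie algebra onto the Kac-Moody algebra. -/
noncomputable def proj : KMFree K H ι →ₗ⁅K⁆ R.KacMoody where
  toLinearMap := R.ideal.toSubmodule.mkQ
  map_lie' := rfl

variable {R} in
theorem proj_eq_zero {z : KMFree K H ι} (hz : R.IsRelator z) : R.proj z = 0 :=
  (Submodule.Quotient.mk_eq_zero R.ideal.toSubmodule).2 (LieSubmodule.subset_lieSpan hz)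

theorem proj_surjective : Function.Surjective R.proj := Submodule.mkQ_surjective _

@[simp] theorem proj_h (t : H) : R.proj (KMFree.h K t) = R.h t := rfl
@[simp] theorem proj_e (i : ι) : R.proj (KMFree.e K i) = R.e i := rfl
@[simp] theorem proj_f (i : ι) : R.proj (KMFree.f K i) = R.f i := rfl

/-- The linear map from `H` to the Kac-Moody algebra. -/
noncomputable def hLin : H →ₗ[K] R.KacMoody where
  toFun := R.h
  map_add' s t := by simpa [sub_eq_zero] using proj_eq_zero (IsRelator.add (R := R) s t)
  map_smul' c t := by simpa [sub_eq_zero] using proj_eq_zero (IsRelator.smul (R := R) c t)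

@[simp] theorem hLin_apply (t : H) : R.hLin t = R.h t := rfl

theorem lie_h_h (s t : H) : ⁅R.h s, R.h t⁆ = 0 := by
  simpa using proj_eq_zero (IsRelator.hh (R := R) s t)

theorem lie_h_e (t : H) (i : ι) : ⁅R.h t, R.e i⁆ = R.root i t • R.e i := by
  simpa [sub_eq_zero] using proj_eq_zero (IsRelator.he (R := R) t i)

theorem lie_h_f (t : H) (i : ι) : ⁅R.h t, R.f i⁆ = -(R.root i t • R.f i) := by
  simpa [add_eq_zero_iff_eq_neg] using proj_eq_zero (IsRelator.hf (R := R) t i)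

theorem lie_e_f_same (i : ι) : ⁅R.e i, R.f i⁆ = R.h (R.coroot i) := by
  simpa [sub_eq_zero] using proj_eq_zero (IsRelator.ef_same (R := R) i)

theorem lie_f_e_same (i : ι) : ⁅R.f i, R.e i⁆ = -R.h (R.coroot i) := by
  rw [← lie_skew, lie_e_f_same]

theorem lie_e_h (t : H) (i : ι) : ⁅R.e i, R.h t⁆ = -(R.root i t • R.e i) := by
  rw [← lie_skew, lie_h_e]

theorem lie_f_h (t : H) (i : ι) : ⁅R.f i, R.h t⁆ = R.root i t • R.f i := by
  rw [← lie_skew, lie_h_f, neg_neg]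

theorem lie_e_f_ne {i j : ι} (hij : i ≠ j) : ⁅R.e i, R.f j⁆ = 0 := by
  simpa using proj_eq_zero (IsRelator.ef_ne (R := R) i j hij)

theorem proj_ad_pow (x y : KMFree K H ι) (n : ℕ) :
    R.proj ((LieAlgebra.ad K (KMFree K H ι) x ^ n) y) =
      (LieAlgebra.ad K R.KacMoody (R.proj x) ^ n) (R.proj y) := by
  induction n with
  | zero => simp
  | succ n ih => simp [pow_succ', ih]

theorem serre_e {i j : ι} (hij : i ≠ j) :
    (LieAlgebra.ad K R.KacMoody (R.e i) ^ (1 - A i j).toNat) (R.e j) = 0 := by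
  simpa [proj_ad_pow] using proj_eq_zero (IsRelator.serre_e (R := R) i j hij)

theorem serre_f {i j : ι} (hij : i ≠ j) :
    (LieAlgebra.ad K R.KacMoody (R.f i) ^ (1 - A i j).toNat) (R.f j) = 0 := by
  simpa [proj_ad_pow] using proj_eq_zero (IsRelator.serre_f (R := R) i j hij)

variable {R} in
theorem eq_top_of_generators_mem {S : LieSubalgebra K R.KacMoody} (hh : ∀ t, R.h t ∈ S)
    (he : ∀ i, R.e i ∈ S) (hf : ∀ i, R.f i ∈ S) : S = ⊤ := by
  let g : KMGenerator H ι → S := fun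
    | .h t => ⟨R.h t, hh t⟩
    | .e i => ⟨R.e i, he i⟩
    | .f i => ⟨R.f i, hf i⟩
  have hg : S.incl.comp (FreeLieAlgebra.lift K g) = R.proj := by
    refine FreeLieAlgebra.hom_ext fun z => ?_
    rcases z with t | i | i <;> simp [g] <;> rfl
  rw [eq_top_iff]
  intro z _
  obtain ⟨y, rfl⟩ := R.proj_surjective z
  rw [← hg]
  exact (FreeLieAlgebra.lift K g y).2

/-- A submodule that is stable under the Chevalley generators and contains them is everything. -/
theorem submodule_eq_top {S : Submodule K R.KacMoody} (hh : ∀ t, R.h t ∈ S)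
    (he : ∀ i, R.e i ∈ S) (hf : ∀ i, R.f i ∈ S) (hh' : ∀ t, ∀ z ∈ S, ⁅R.h t, z⁆ ∈ S)
    (he' : ∀ i, ∀ z ∈ S, ⁅R.e i, z⁆ ∈ S) (hf' : ∀ i, ∀ z ∈ S, ⁅R.f i, z⁆ ∈ S) : S = ⊤ := by
  -- The elements that preserve $S$ under bracketing form a subalgebra; it contains the generators,
  -- so $S$ is stable under everything and is itself a subalgebra.
  let T : LieSubalgebra K R.KacMoody :=
    { carrier := {x | ∀ z ∈ S, ⁅x, z⁆ ∈ S}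
      add_mem' := fun ha hb z hz => by rw [add_lie]; exact add_mem (ha z hz) (hb z hz)
      zero_mem' := fun z _ => by simp
      smul_mem' := fun c x hx z hz => by rw [smul_lie]; exact S.smul_mem c (hx z hz)
      lie_mem' := fun hx hy z hz => by
        rw [lie_lie]; exact sub_mem (hx _ (hy z hz)) (hy _ (hx z hz)) }
  have hT : T = ⊤ := eq_top_of_generators_mem hh' he' hf'
  let S' : LieSubalgebra K R.KacMoody :=
    { S with lie_mem' := fun {x y} _ hy => (hT ▸ LieSubalgebra.mem_top x : x ∈ T) y hy }
  have hS' : S' = ⊤ := eq_top_of_generators_mem hh he hf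
  rw [eq_top_iff]
  intro z _
  exact (hS' ▸ LieSubalgebra.mem_top z : z ∈ S')

/-! ### Root spaces -/

variable {R} in
theorem mem_rootSpace {k : ι → ℤ} {x : R.KacMoody} :
    x ∈ R.rootSpace k ↔ ∀ t, ⁅R.h t, x⁆ = R.weight k t • x := Iff.rfl

theorem weight_add (k l : ι → ℤ) : R.weight (k + l) = R.weight k + R.weight l := by
  simp [weight, add_smul, Finset.sum_add_distrib]

theorem weight_neg (k : ι → ℤ) : R.weight (-k) = -R.weight k := by
  simp [weight]

theorem weight_single [DecidableEq ι] (i : ι) : R.weight (Pi.single i 1) = R.root i := by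
  simp [weight, Pi.single_apply]

theorem weight_coroot (k : ι → ℤ) (i : ι) : R.weight k (R.coroot i) = ((A.mulVec k i : ℤ) : K) := by
  simp [weight, R.root_coroot, Matrix.mulVec, dotProduct, mul_comm]

theorem weight_injective [CharZero K] : Function.Injective R.weight := by
  intro k l hkl
  have h : ∑ i, ((k i - l i : ℤ) : K) • R.root i = 0 := by
    have : ∑ i, k i • R.root i = ∑ i, l i • R.root i := hkl
    have h (i : ι) : ((k i - l i : ℤ) : K) • R.root i = k i • R.root i - l i • R.root i :=
      LinearMap.ext fun t => by simp [sub_mul]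
    rw [Finset.sum_congr rfl fun i _ => h i, Finset.sum_sub_distrib, this, sub_self]
  ext i
  have := Fintype.linearIndependent_iff.1 R.linearIndependent_root _ h i
  exact sub_eq_zero.1 (by exact_mod_cast this)

/-- The operators $\operatorname{ad} h$ commute, so their simultaneous generalized eigenspaces are
independent; distinct `k` give distinct weights by `weight_injective`. -/
theorem iSupIndep_rootSpace [CharZero K] : iSupIndep R.rootSpace := by
  have h := Module.End.independent_iInf_maxGenEigenspace_of_forall_mapsTo
    (fun t => LieAlgebra.ad K R.KacMoody (R.h t)) (fun s t c => by
      refine Module.End.mapsTo_maxGenEigenspace_of_comm ?_ c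
      refine LinearMap.ext fun x => ?_
      change ⁅R.h t, ⁅R.h s, x⁆⁆ = ⁅R.h s, ⁅R.h t, x⁆⁆
      rw [leibniz_lie, lie_h_h, zero_lie, zero_add])
  refine (h.comp (f := fun k : ι → ℤ => fun t => R.weight k t) fun k l hkl =>
    R.weight_injective (LinearMap.ext (congrFun hkl))).mono fun k x hx => ?_
  refine (Submodule.mem_iInf _).2 fun t => ?_
  exact Module.End.mem_maxGenEigenspace _ _ _ |>.2 ⟨1, by simp [hx t]⟩

theorem eq_of_mem_rootSpace [CharZero K] {k l : ι → ℤ} {x : R.KacMoody} (hx : x ∈ R.rootSpace k)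
    (hx' : x ∈ R.rootSpace l) (h0 : x ≠ 0) : k = l := by
  by_contra h
  exact h0 (Submodule.disjoint_def.1 (R.iSupIndep_rootSpace.pairwiseDisjoint h) x hx hx')

variable {R} in
theorem lie_mem_rootSpace {k l : ι → ℤ} {x y : R.KacMoody} (hx : x ∈ R.rootSpace k)
    (hy : y ∈ R.rootSpace l) : ⁅x, y⁆ ∈ R.rootSpace (k + l) := by
  intro t
  rw [leibniz_lie, hx t, hy t, weight_add, smul_lie, lie_smul, LinearMap.add_apply, add_smul]

theorem h_mem_rootSpace (t : H) : R.h t ∈ R.rootSpace 0 := by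
  intro s
  rw [lie_h_h]
  simp [weight]

section

variable [DecidableEq ι]

theorem e_mem_rootSpace (i : ι) : R.e i ∈ R.rootSpace (Pi.single i 1) := by
  intro t
  rw [lie_h_e, weight_single]

theorem f_mem_rootSpace (i : ι) : R.f i ∈ R.rootSpace (-Pi.single i 1) := by
  intro t
  rw [lie_h_f, weight_neg, weight_single, LinearMap.neg_apply, neg_smul]

variable {R} in
theorem isWord_e_mem {k : ι → ℤ} {w : R.KacMoody} (hw : IsWord R.e k w) : w ∈ R.rootSpace k := by
  induction hw with
  | single i => exact R.e_mem_rootSpace i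
  | cons i k w _ ih => exact lie_mem_rootSpace (R.e_mem_rootSpace i) ih

variable {R} in
theorem isWord_f_mem {k : ι → ℤ} {w : R.KacMoody} (hw : IsWord R.f k w) :
    w ∈ R.rootSpace (-k) := by
  induction hw with
  | single i => exact R.f_mem_rootSpace i
  | cons i k w _ ih =>
    rw [neg_add]
    exact lie_mem_rootSpace (R.f_mem_rootSpace i) ih

/-- The words in the `e_i`, the words in the `f_i`, and the elements of the Cartan subalgebra. -/
def spanningSet : Set R.KacMoody :=
  {w | ∃ k, IsWord R.e k w} ∪ {w | ∃ k, IsWord R.f k w} ∪ Set.range R.h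

/-- The triangular decomposition. -/
theorem span_spanningSet : Submodule.span K R.spanningSet = ⊤ := by
  have hext (x : R.KacMoody) (h : ∀ z ∈ R.spanningSet, ⁅x, z⁆ ∈ Submodule.span K R.spanningSet) :
      ∀ z ∈ Submodule.span K R.spanningSet, ⁅x, z⁆ ∈ Submodule.span K R.spanningSet := by
    intro z hz
    induction hz using Submodule.span_induction with
    | mem z hz => exact h z hz
    | zero => simp
    | add a b _ _ ha hb => rw [lie_add]; exact add_mem ha hb
    | smul c a _ ha => rw [lie_smul]; exact Submodule.smul_mem _ c ha
  have he {k w} (hw : IsWord R.e k w) : w ∈ Submodule.span K R.spanningSet :=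
    Submodule.subset_span (.inl (.inl ⟨k, hw⟩))
  have hf {k w} (hw : IsWord R.f k w) : w ∈ Submodule.span K R.spanningSet :=
    Submodule.subset_span (.inl (.inr ⟨k, hw⟩))
  have hh (t) : R.h t ∈ Submodule.span K R.spanningSet := Submodule.subset_span (.inr ⟨t, rfl⟩)
  have hef (i j : ι) : ⁅R.e i, R.f j⁆ ∈ LinearMap.range R.hLin := by
    by_cases hij : i = j
    · subst hij
      exact ⟨R.coroot i, (R.lie_e_f_same i).symm⟩
    · rw [R.lie_e_f_ne hij]
      exact zero_mem _
  have hrange : LinearMap.range R.hLin ≤ Submodule.span K R.spanningSet := by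
    rintro _ ⟨t, rfl⟩
    exact hh t
  have hsupE : Submodule.span K {w | ∃ k, IsWord R.e k w} ⊔ LinearMap.range R.hLin ≤
      Submodule.span K R.spanningSet :=
    sup_le (Submodule.span_le.2 fun _ ⟨_, hw⟩ => he hw) hrange
  have hsupF : Submodule.span K {w | ∃ k, IsWord R.f k w} ⊔ LinearMap.range R.hLin ≤
      Submodule.span K R.spanningSet :=
    sup_le (Submodule.span_le.2 fun _ ⟨_, hw⟩ => hf hw) hrange
  refine R.submodule_eq_top hh (fun i => he (.single i)) (fun i => hf (.single i))
    (fun t => hext _ ?_) (fun i => hext _ ?_) (fun i => hext _ ?_)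
  · rintro _ ((⟨k, hw⟩ | ⟨k, hw⟩) | ⟨s, rfl⟩)
    · rw [isWord_e_mem hw t]
      exact Submodule.smul_mem _ _ (he hw)
    · rw [isWord_f_mem hw t]
      exact Submodule.smul_mem _ _ (hf hw)
    · simp [lie_h_h]
  · rintro _ ((⟨k, hw⟩ | ⟨k, hw⟩) | ⟨s, rfl⟩)
    · exact he (hw.cons i)
    · refine hsupF (IsWord.lie_mem (hef i) (fun t k w hw => ?_) hw)
      rw [hLin_apply, isWord_f_mem hw t]
      exact Submodule.smul_mem _ _ (Submodule.mem_span_singleton_self w)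
    · rw [lie_e_h]
      exact neg_mem (Submodule.smul_mem _ _ (he (.single i)))
  · rintro _ ((⟨k, hw⟩ | ⟨k, hw⟩) | ⟨s, rfl⟩)
    · refine hsupE (IsWord.lie_mem (fun j => ?_) (fun t k w hw => ?_) hw)
      · rw [← lie_skew]
        exact neg_mem (hef j i)
      · rw [hLin_apply, isWord_e_mem hw t]
        exact Submodule.smul_mem _ _ (Submodule.mem_span_singleton_self w)
    · exact hf (hw.cons i)
    · rw [lie_f_h]
      exact Submodule.smul_mem _ _ (hf (.single i))

variable [CharZero K]

theorem rootSpace_eq_span (k : ι → ℤ) :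
    R.rootSpace k = Submodule.span K (R.spanningSet ∩ R.rootSpace k) := by
  refine R.iSupIndep_rootSpace.eq_span_inter R.span_spanningSet ?_ k
  rintro _ ((⟨k, hw⟩ | ⟨k, hw⟩) | ⟨s, rfl⟩)
  · exact ⟨k, isWord_e_mem hw⟩
  · exact ⟨-k, isWord_f_mem hw⟩
  · exact ⟨0, R.h_mem_rootSpace s⟩

/-- A nonzero root space contains a nonzero word of the same degree. -/
theorem exists_isWord {k : ι → ℤ} (hk : R.rootSpace k ≠ ⊥) :
    (∃ w ≠ 0, IsWord R.e k w) ∨ (∃ w ≠ 0, IsWord R.f (-k) w) ∨ k = 0 := by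
  obtain ⟨z, ⟨hz, hzk⟩, hz0⟩ : ∃ z ∈ R.spanningSet ∩ R.rootSpace k, z ≠ 0 := by
    by_contra! h
    rw [rootSpace_eq_span] at hk
    exact hk (Submodule.span_eq_bot.2 h)
  rcases hz with (⟨l, hw⟩ | ⟨l, hw⟩) | ⟨s, rfl⟩
  · obtain rfl := R.eq_of_mem_rootSpace hzk (isWord_e_mem hw) hz0
    exact .inl ⟨z, hz0, hw⟩
  · obtain rfl := R.eq_of_mem_rootSpace hzk (isWord_f_mem hw) hz0
    exact .inr (.inl ⟨z, hz0, by rwa [neg_neg]⟩)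
  · exact .inr (.inr (R.eq_of_mem_rootSpace hzk (R.h_mem_rootSpace s) hz0))

/-- Every root is positive or negative. -/
theorem nonneg_or_nonpos {k : ι → ℤ} (hk : R.rootSpace k ≠ ⊥) : 0 ≤ k ∨ k ≤ 0 := by
  rcases R.exists_isWord hk with ⟨w, -, hw⟩ | ⟨w, -, hw⟩ | rfl
  · exact .inl hw.pos.le
  · exact .inr (by simpa using hw.pos.le)
  · exact .inl le_rfl

/-- The only multiples of a simple root that are roots are the simple root and its negative. -/
theorem abs_le_one {k : ι → ℤ} (hk : R.rootSpace k ≠ ⊥) {i : ι} (hki : ∀ j ≠ i, k j = 0) :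
    |k i| ≤ 1 := by
  rcases R.exists_isWord hk with ⟨w, hw0, hw⟩ | ⟨w, hw0, hw⟩ | rfl
  · rcases hw.of_support_subset hki with ⟨h, -⟩ | h
    · simp [h]
    · exact absurd h hw0
  · rcases hw.of_support_subset (i := i) (by simpa using hki) with ⟨h, -⟩ | h
    · rw [← abs_neg, show -k i = 1 from h, abs_one]
    · exact absurd h hw0
  · simp

theorem rootSpace_single (i : ι) : R.rootSpace (Pi.single i 1) = Submodule.span K {R.e i} := by
  refine le_antisymm ?_ (by simpa using R.e_mem_rootSpace i)
  rw [rootSpace_eq_span, Submodule.span_le]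
  rintro z ⟨hz, hzk⟩
  by_cases hz0 : z = 0
  · simp [hz0]
  rcases hz with (⟨l, hw⟩ | ⟨l, hw⟩) | ⟨s, rfl⟩
  · obtain rfl := R.eq_of_mem_rootSpace hzk (isWord_e_mem hw) hz0
    rcases hw.of_support_subset (i := i) (by simp +contextual) with ⟨-, h⟩ | h
    · rw [h]
      exact Submodule.mem_span_singleton_self _
    · exact absurd h hz0
  · have h := R.eq_of_mem_rootSpace hzk (isWord_f_mem hw) hz0
    have := hw.pos.le i
    have := congrFun h i
    simp at *
    omega
  · have h := congrFun (R.eq_of_mem_rootSpace hzk (R.h_mem_rootSpace s) hz0) i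
    simp at h

end

end Realization

/-! ### Strings through a root -/

open LieModule in
/-- In a representation of `sl₂` in which `e` acts nilpotently on a vector `x` of weight `m > 0`,
some vector `f ^ (m + 2 p) e ^ p x` is nonzero. -/
theorem exists_f_pow_e_pow_ne_zero {K L M : Type*} [Field K] [CharZero K] [LieRing L]
    [LieAlgebra K L] [AddCommGroup M] [Module K M] [LieRingModule L M] [LieModule K L M]
    {h e f : L} (t : IsSl2Triple h e f) {x : M} {m : ℕ} (hx : x ≠ 0)
    (hhx : ⁅h, x⁆ = (m : K) • x) (hex : ∃ n : ℕ, (toEnd K L M e ^ n) x = 0) :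
    ∃ p : ℕ, (toEnd K L M f ^ (m + 2 * p)) ((toEnd K L M e ^ p) x) ≠ 0 := by
  classical
  -- Here $e^p x$ is the last nonzero vector: a primitive vector of weight $m+2p$.
  obtain ⟨p, hp⟩ : ∃ p, Nat.find hex = p + 1 := Nat.exists_eq_succ_of_ne_zero fun h0 => by
    have := Nat.find_spec hex
    rw [h0] at this
    exact hx (by simpa using this)
  have hp1 : (toEnd K L M e ^ (p + 1)) x = 0 := hp ▸ Nat.find_spec hex
  have hp0 : (toEnd K L M e ^ p) x ≠ 0 := Nat.find_min hex (by omega)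
  have hh (q : ℕ) : ⁅h, (toEnd K L M e ^ q) x⁆ = ((m + 2 * q : ℕ) : K) • (toEnd K L M e ^ q) x := by
    induction q with
    | zero => simpa using hhx
    | succ q ih =>
      rw [pow_succ', Module.End.mul_apply, toEnd_apply_apply, leibniz_lie, t.lie_h_e_smul K, ih,
        lie_smul, smul_lie, ← add_smul]
      push_cast
      ring_nf
  have P : t.HasPrimitiveVectorWith ((toEnd K L M e ^ p) x) ((m + 2 * p : ℕ) : K) :=
    ⟨hp0, hh p, by simpa [pow_succ'] using hp1⟩
  refine ⟨p, ?_⟩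
  suffices H : ∀ q ≤ m + 2 * p, (toEnd K L M f ^ q) ((toEnd K L M e ^ p) x) ≠ 0 from H _ le_rfl
  intro q hq
  induction q with
  | zero => simpa using hp0
  | succ q ih =>
    intro h0
    -- $e f^{q+1}v=(q+1)(m+2p-q)f^q v$ for $v=e^p x$, with nonzero coefficient as long as $q<m+2p$.
    have := P.lie_e_pow_succ_toEnd_f q
    rw [h0, lie_zero] at this
    rcases smul_eq_zero.1 this.symm with h1 | h1
    · rcases mul_eq_zero.1 h1 with h2 | h2
      · exact Nat.cast_add_one_ne_zero q h2
      · have : m + 2 * p = q := by exact_mod_cast sub_eq_zero.1 h2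
        omega
    · exact ih (by omega) h1

namespace Realization

variable {K : Type*} [Field K] {ι : Type*} [Fintype ι] {A : Matrix ι ι ℤ}
  {H : Type*} [AddCommGroup H] [Module K H] (R : Realization K A H)

/-- Local nilpotence of $\operatorname{ad} e_i$: the Engel set is a subalgebra, so it is enough to
test generators, and the Serre relations settle the $e_j$. -/
theorem engel_e (i : ι) : LieSubalgebra.engel K (R.e i) = ⊤ := by
  classical
  refine eq_top_of_generators_mem (fun t => ?_) (fun j => ?_) (fun j => ?_) <;>
    rw [LieSubalgebra.mem_engel_iff]
  · refine ⟨2, ?_⟩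
    rw [pow_two, Module.End.mul_apply, LieAlgebra.ad_apply, LieAlgebra.ad_apply, lie_e_h]
    simp
  · by_cases hij : i = j
    · exact ⟨1, by simp [hij]⟩
    · exact ⟨_, R.serre_e hij⟩
  · by_cases hij : i = j
    · subst hij
      refine ⟨3, ?_⟩
      rw [pow_succ', pow_two, Module.End.mul_apply, Module.End.mul_apply, LieAlgebra.ad_apply,
        LieAlgebra.ad_apply, LieAlgebra.ad_apply, lie_e_f_same, lie_e_h]
      simp
    · exact ⟨1, by simpa using R.lie_e_f_ne hij⟩

theorem engel_f (i : ι) : LieSubalgebra.engel K (R.f i) = ⊤ := by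
  classical
  refine eq_top_of_generators_mem (fun t => ?_) (fun j => ?_) (fun j => ?_) <;>
    rw [LieSubalgebra.mem_engel_iff]
  · refine ⟨2, ?_⟩
    rw [pow_two, Module.End.mul_apply, LieAlgebra.ad_apply, LieAlgebra.ad_apply, lie_f_h]
    simp
  · by_cases hij : j = i
    · subst hij
      refine ⟨3, ?_⟩
      rw [pow_succ', pow_two, Module.End.mul_apply, Module.End.mul_apply, LieAlgebra.ad_apply,
        LieAlgebra.ad_apply, LieAlgebra.ad_apply, lie_f_e_same, lie_neg, lie_f_h]
      simp
    · refine ⟨1, ?_⟩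
      rw [pow_one, LieAlgebra.ad_apply, ← lie_skew, R.lie_e_f_ne hij, neg_zero]
  · by_cases hij : i = j
    · exact ⟨1, by simp [hij]⟩
    · exact ⟨_, R.serre_f hij⟩

theorem lie_coroot {k : ι → ℤ} {x : R.KacMoody} (hx : x ∈ R.rootSpace k) (i : ι) :
    ⁅R.h (R.coroot i), x⁆ = ((A.mulVec k i : ℤ) : K) • x := by
  rw [hx, weight_coroot]

theorem isSl2Triple (hA : ∀ i, A i i = 2) {i : ι} (h0 : R.h (R.coroot i) ≠ 0) :
    IsSl2Triple (R.h (R.coroot i)) (R.e i) (R.f i) where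
  h_ne_zero := h0
  lie_e_f := R.lie_e_f_same i
  lie_h_e_nsmul := by
    rw [lie_h_e, R.root_coroot, hA, Int.cast_ofNat, ofNat_smul_eq_nsmul]
  lie_h_f_nsmul := by
    rw [lie_h_f, R.root_coroot, hA, Int.cast_ofNat, ofNat_smul_eq_nsmul]

theorem ad_pow_mem {y : R.KacMoody} {l : ι → ℤ} (hy : y ∈ R.rootSpace l) {k : ι → ℤ}
    {x : R.KacMoody} (hx : x ∈ R.rootSpace k) (n : ℕ) :
    (LieAlgebra.ad K R.KacMoody y ^ n) x ∈ R.rootSpace (k + n • l) := by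
  induction n with
  | zero => simpa using hx
  | succ n ih =>
    rw [pow_succ', Module.End.mul_apply, succ_nsmul', add_left_comm]
    exact lie_mem_rootSpace hy ih

/-- Supplies the condition $h\ne 0$ of `IsSl2Triple` without knowing that $H$ embeds into the
quotient: the coroot acts on a root vector by a nonzero scalar. -/
theorem coroot_ne_zero [CharZero K] {k : ι → ℤ} (hk : R.rootSpace k ≠ ⊥) {i : ι} (hki : A.mulVec k i ≠ 0) :
    R.h (R.coroot i) ≠ 0 := by
  intro h0
  obtain ⟨x, hx, hx0⟩ := (Submodule.ne_bot_iff _).1 hk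
  have := R.lie_coroot hx i
  rw [h0, zero_lie] at this
  exact (smul_ne_zero (Int.cast_ne_zero.2 hki) hx0) this.symm

/-- Every root `k` that pairs to `m ≠ 0` with the `i`-th coroot has a string that leads at least as
far as the reflection of `k`. -/
theorem exists_string [DecidableEq ι] [CharZero K] (hA : ∀ i, A i i = 2) {k : ι → ℤ} (hk : R.rootSpace k ≠ ⊥) {i : ι}
    (hki : A.mulVec k i ≠ 0) :
    ∃ c : ℤ, 0 < c * A.mulVec k i ∧ 0 ≤ c * (c - A.mulVec k i) ∧
      R.rootSpace (k - c • Pi.single i 1) ≠ ⊥ := by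
  have t := R.isSl2Triple hA (R.coroot_ne_zero hk hki)
  obtain ⟨x, hx, hx0⟩ := (Submodule.ne_bot_iff _).1 hk
  have hlie := R.lie_coroot hx i
  obtain ⟨m, hm | hm⟩ := Int.eq_nat_or_neg (A.mulVec k i) <;> rw [hm] at hki hlie ⊢
  · have hn : ∃ n : ℕ, (LieAlgebra.ad K R.KacMoody (R.e i) ^ n) x = 0 := by
      rw [← LieSubalgebra.mem_engel_iff, engel_e]
      trivial
    obtain ⟨p, hp⟩ := exists_f_pow_e_pow_ne_zero t hx0 (by simpa using hlie) hn
    have hmem := R.ad_pow_mem (R.f_mem_rootSpace i) (R.ad_pow_mem (R.e_mem_rootSpace i) hx p)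
      (m + 2 * p)
    -- Going up $p$ steps and down $m+2p$ is a net descent by $c=m+p$. The two inequalities say that
    -- $c$ has the sign of the pairing and at least its absolute value, for both signs at once.
    refine ⟨m + p, ?_, ?_, (Submodule.ne_bot_iff _).2 ⟨_, ?_, hp⟩⟩
    · have : 0 < m := by omega
      positivity
    · rw [add_sub_cancel_left]
      positivity
    · have : k - (m + p : ℤ) • Pi.single i 1 =
          k + p • Pi.single i 1 + (m + 2 * p) • -Pi.single i 1 := by
        module
      rw [this]
      exact hmem
  · have hn : ∃ n : ℕ, (LieAlgebra.ad K R.KacMoody (R.f i) ^ n) x = 0 := by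
      rw [← LieSubalgebra.mem_engel_iff, engel_f]
      trivial
    obtain ⟨p, hp⟩ := exists_f_pow_e_pow_ne_zero t.symm hx0 (m := m) (by simp [hlie]) hn
    have hmem := R.ad_pow_mem (R.e_mem_rootSpace i) (R.ad_pow_mem (R.f_mem_rootSpace i) hx p)
      (m + 2 * p)
    refine ⟨-(m + p), ?_, ?_, (Submodule.ne_bot_iff _).2 ⟨_, ?_, hp⟩⟩
    · have : 0 < m := by omega
      rw [neg_mul_neg]
      positivity
    · have : (-(m + p : ℤ)) * (-(m + p) - -m) = (m + p) * p := by ring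
      rw [this]
      positivity
    · have : k - (-(m + p) : ℤ) • Pi.single i 1 =
          k + p • -Pi.single i 1 + (m + 2 * p) • Pi.single i 1 := by
        module
      rw [this]
      exact hmem

end Realization

/-! ### The quadratic form -/

namespace Matrix

variable {ι : Type*} [Fintype ι]

/-- The quadratic form of an integral matrix. -/
def quadForm (A : Matrix ι ι ℤ) (k : ι → ℤ) : ℤ := k ⬝ᵥ A *ᵥ k

variable {A : Matrix ι ι ℤ}

theorem IsSymm.quadForm_add (hA : A.IsSymm) (k l : ι → ℤ) :
    A.quadForm (k + l) = A.quadForm k + 2 * (l ⬝ᵥ A *ᵥ k) + A.quadForm l := by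
  have h : k ⬝ᵥ A *ᵥ l = l ⬝ᵥ A *ᵥ k := by
    rw [dotProduct_mulVec, ← mulVec_transpose, hA.eq, dotProduct_comm]
  simp only [quadForm, mulVec_add, dotProduct_add, add_dotProduct, h]
  ring

theorem quadForm_smul (c : ℤ) (k : ι → ℤ) : A.quadForm (c • k) = c ^ 2 * A.quadForm k := by
  simp only [quadForm, mulVec_smul, dotProduct_smul, smul_dotProduct, smul_eq_mul]
  ring

variable [DecidableEq ι]

theorem IsSymm.quadForm_add_smul_single (hA : A.IsSymm) (hA' : ∀ i, A i i = 2) (k : ι → ℤ) (c : ℤ)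
    (i : ι) :
    A.quadForm (k + c • Pi.single i 1) = A.quadForm k + 2 * c * (A *ᵥ k) i + 2 * c ^ 2 := by
  rw [hA.quadForm_add, quadForm_smul]
  have : A.quadForm (Pi.single i 1) = 2 := by simp [quadForm, hA']
  rw [this, smul_dotProduct, single_one_dotProduct, smul_eq_mul]
  ring

theorem IsSymm.quadForm_sub_smul_single (hA : A.IsSymm) (hA' : ∀ i, A i i = 2) (k : ι → ℤ) (c : ℤ)
    (i : ι) :
    A.quadForm (k - c • Pi.single i 1) = A.quadForm k - 2 * c * (A *ᵥ k) i + 2 * c ^ 2 := by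
  rw [sub_eq_add_neg, ← neg_smul, hA.quadForm_add_smul_single hA']
  ring

theorem IsSymm.quadForm_of_isRealRoot (hA : A.IsSymm) (hA' : ∀ i, A i i = 2) {k : ι → ℤ}
    (hk : IsRealRoot A k) : A.quadForm k = 2 := by
  induction hk with
  | simple i => simp [quadForm, hA']
  | reflect i k _ ih =>
    rw [hA.quadForm_sub_smul_single hA', ih]
    simp only [mulVec, dotProduct]
    ring

end Matrix

open Matrix

/-! ### The norm bound for roots -/

namespace Realization

variable {K : Type*} [Field K] [CharZero K] {ι : Type*} [Fintype ι] [DecidableEq ι]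
  {A : Matrix ι ι ℤ} {H : Type*} [AddCommGroup H] [Module K H] (R : Realization K A H)

/-- The norm of a root is at most that of the simple roots. -/
theorem quadForm_le_two (hA : A.IsSymm) (hA' : ∀ i, A i i = 2) {k : ι → ℤ}
    (hk : R.rootSpace k ≠ ⊥) : A.quadForm k ≤ 2 := by
  induction hn : ∑ i, (k i).natAbs using Nat.strong_induction_on generalizing k with
  | _ n ih =>
  by_contra! hlt
  obtain ⟨i, -, hi⟩ : ∃ i ∈ Finset.univ, 0 < k i * (A *ᵥ k) i := by
    refine Finset.exists_lt_of_sum_lt (f := fun _ => 0) ?_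
    have h : 0 < ∑ i, k i * (A *ᵥ k) i := zero_lt_two.trans hlt
    simpa using h
  have hki : (A *ᵥ k) i ≠ 0 := by rintro h; simp [h] at hi
  obtain ⟨c, hc, hc', hroot⟩ := R.exists_string hA' hk hki
  have hq := hA.quadForm_sub_smul_single hA' k c i
  -- A multiple of $\alpha_i$ that is a root is $\pm\alpha_i$, of norm $2$. So another coordinate is
  -- nonzero; the string leaves it fixed and it determines the sign of `k'`.
  obtain ⟨j, hji, hj⟩ : ∃ j ≠ i, k j ≠ 0 := by
    by_contra! h
    have h1 := R.abs_le_one hk h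
    have hk' : k = k i • Pi.single i 1 := by
      ext j
      by_cases hj : j = i
      · subst hj; simp
      · simp [hj, h j hj]
    have h2 : A.quadForm (Pi.single i 1) = 2 := by simp [quadForm, hA']
    rw [hk', quadForm_smul, h2] at hlt
    have := sq_le_one_iff_abs_le_one (k i) |>.2 h1
    omega
  set k' := k - c • Pi.single i 1 with hk'
  have hk'j : ∀ l ≠ i, k' l = k l := fun l hl => by simp [hk', hl]
  have hk'i : k' i = k i - c := by simp [hk']
  have hlt' : (k' i).natAbs < (k i).natAbs := by
    -- `c` has the sign of `k i`, and sign coherence with coordinate `j` keeps `k' i` from crossing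
    -- zero.
    have hs : (0 < k i ∧ 0 < c ∧ 0 ≤ k' i) ∨ (k i < 0 ∧ c < 0 ∧ k' i ≤ 0) := by
      have h1 : 0 < k i * c := by
        have : 0 < (k i * c) * (A *ᵥ k) i ^ 2 := by nlinarith
        exact pos_of_mul_pos_left this (sq_nonneg _)
      rcases R.nonneg_or_nonpos hk with h | h <;> rcases R.nonneg_or_nonpos hroot with h' | h'
      · rcases pos_and_pos_or_neg_and_neg_of_mul_pos h1 with h2 | h2
        · exact .inl ⟨h2.1, h2.2, h' i⟩
        · exact absurd (h i) (not_le.2 h2.1)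
      · exact absurd (le_antisymm (hk'j j hji ▸ h' j) (h j)) hj
      · exact absurd (le_antisymm (h j) (hk'j j hji ▸ h' j)) hj
      · rcases pos_and_pos_or_neg_and_neg_of_mul_pos h1 with h2 | h2
        · exact absurd (h i) (not_le.2 h2.1)
        · exact .inr ⟨h2.1, h2.2, h' i⟩
    omega
  have hsum : ∑ l, (k' l).natAbs < n := by
    rw [← hn]
    refine Finset.sum_lt_sum (fun l _ => ?_) ⟨i, Finset.mem_univ i, hlt'⟩
    by_cases hl : l = i
    · exact hl ▸ hlt'.le
    · rw [hk'j l hl]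
  have := ih _ hsum hroot rfl
  -- $q(k')=q(k)+2c(c-(Ak)_i)\ge q(k)>2$, against the induction hypothesis.
  nlinarith

variable {R} in
theorem eq_zero_of_two_lt_quadForm (hA : A.IsSymm) (hA' : ∀ i, A i i = 2) {k : ι → ℤ}
    (hk : 2 < A.quadForm k) {x : R.KacMoody} (hx : x ∈ R.rootSpace k) : x = 0 := by
  have h : R.rootSpace k = ⊥ := by
    by_contra h
    exact absurd (R.quadForm_le_two hA hA' h) (not_le.2 hk)
  rw [h] at hx
  exact (Submodule.mem_bot K).1 hx

end Realization

/-! ### The type `E₉` -/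

theorem isSymm_cartanE9 : cartanE9.IsSymm := by decide

theorem cartanE9_diag : ∀ i, cartanE9 i i = 2 := by decide

/-- Squares are completed from the tips of the three arms towards the branch node 4. Arms of lengths
$1,2,5$ use up $\tfrac12+\tfrac23+\tfrac56=2$, the whole coefficient of $k_4^2$, so eight squares
remain in nine variables and the kernel is a line. -/
theorem quadForm_cartanE9 (k : Fin 9 → ℤ) :
    60 * cartanE9.quadForm k = 30 * (2 * k 1 - k 3) ^ 2 + 10 * (3 * k 3 - 2 * k 4) ^ 2 +
      30 * (2 * k 2 - k 4) ^ 2 + 30 * (2 * k 0 - k 8) ^ 2 + 10 * (3 * k 8 - 2 * k 7) ^ 2 +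
      5 * (4 * k 7 - 3 * k 6) ^ 2 + 3 * (5 * k 6 - 4 * k 5) ^ 2 + 2 * (6 * k 5 - 5 * k 4) ^ 2 := by
  simp [quadForm, dotProduct, mulVec, cartanE9, Fin.sum_univ_succ]
  ring

theorem quadForm_cartanE9_nonneg (k : Fin 9 → ℤ) : 0 ≤ cartanE9.quadForm k := by
  have := quadForm_cartanE9 k
  have : 0 ≤ 60 * cartanE9.quadForm k := by rw [this]; positivity
  omega

theorem eq_smul_deltaE9 {k : Fin 9 → ℤ} (hk : cartanE9.quadForm k = 0) : k = k 0 • deltaE9 := by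
  have h := quadForm_cartanE9 k
  rw [hk, mul_zero] at h
  have h1 := sq_nonneg (2 * k 1 - k 3)
  have h2 := sq_nonneg (3 * k 3 - 2 * k 4)
  have h3 := sq_nonneg (2 * k 2 - k 4)
  have h4 := sq_nonneg (2 * k 0 - k 8)
  have h5 := sq_nonneg (3 * k 8 - 2 * k 7)
  have h6 := sq_nonneg (4 * k 7 - 3 * k 6)
  have h7 := sq_nonneg (5 * k 6 - 4 * k 5)
  have h8 := sq_nonneg (6 * k 5 - 5 * k 4)
  have e1 := pow_eq_zero_iff two_ne_zero |>.1 (by omega : (2 * k 1 - k 3) ^ 2 = 0)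
  have e2 := pow_eq_zero_iff two_ne_zero |>.1 (by omega : (3 * k 3 - 2 * k 4) ^ 2 = 0)
  have e3 := pow_eq_zero_iff two_ne_zero |>.1 (by omega : (2 * k 2 - k 4) ^ 2 = 0)
  have e4 := pow_eq_zero_iff two_ne_zero |>.1 (by omega : (2 * k 0 - k 8) ^ 2 = 0)
  have e5 := pow_eq_zero_iff two_ne_zero |>.1 (by omega : (3 * k 8 - 2 * k 7) ^ 2 = 0)
  have e6 := pow_eq_zero_iff two_ne_zero |>.1 (by omega : (4 * k 7 - 3 * k 6) ^ 2 = 0)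
  have e7 := pow_eq_zero_iff two_ne_zero |>.1 (by omega : (5 * k 6 - 4 * k 5) ^ 2 = 0)
  have e8 := pow_eq_zero_iff two_ne_zero |>.1 (by omega : (6 * k 5 - 5 * k 4) ^ 2 = 0)
  have d : deltaE9 = ![1, 2, 3, 4, 6, 5, 4, 3, 2] := by decide
  rw [d]
  ext i
  fin_cases i <;> simp <;> omega

theorem mulVec_cartanE9_le_two {k : Fin 9 → ℤ} (hk : cartanE9.quadForm k = 2) (i : Fin 9) :
    (cartanE9 *ᵥ k) i ≤ 2 := by
  have h := isSymm_cartanE9.quadForm_sub_smul_single cartanE9_diag k 1 i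
  have := quadForm_cartanE9_nonneg (k - (1 : ℤ) • Pi.single i 1)
  omega

/-- $q(k-\alpha_i)=4-2(k,\alpha_i)\le 0$, so $k-\alpha_i$ lies in the radical. -/
theorem eq_add_smul_deltaE9 {k : Fin 9 → ℤ} (hk : cartanE9.quadForm k = 2) {i : Fin 9}
    (hki : 2 ≤ (cartanE9 *ᵥ k) i) : ∃ c : ℤ, k = Pi.single i 1 + c • deltaE9 := by
  have h := isSymm_cartanE9.quadForm_sub_smul_single cartanE9_diag k 1 i
  have := quadForm_cartanE9_nonneg (k - (1 : ℤ) • Pi.single i 1)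
  refine ⟨_, sub_eq_iff_eq_add'.1 (eq_smul_deltaE9 (k := k - Pi.single i 1) ?_)⟩
  rw [one_smul] at h this
  omega

theorem deltaE9_pos : ∀ i, 0 < deltaE9 i := by decide

theorem eq_zero_of_deltaE9_le_one : ∀ i, deltaE9 i ≤ 1 → i = 0 := by decide

namespace Realization

variable {K : Type*} [Field K] {H : Type*} [AddCommGroup H] [Module K H]

/-! ### Generators of the derived algebra -/

section derived

variable {ι : Type*} [Fintype ι] {A : Matrix ι ι ℤ} (R : Realization K A H)

variable {R} in
theorem mem_derived_of_mem_rootSpace [CharZero K] {k : ι → ℤ} (hk : k ≠ 0) {x : R.KacMoody}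
    (hx : x ∈ R.rootSpace k) : x ∈ R.derived := by
  obtain ⟨t, ht⟩ : ∃ t, R.weight k t ≠ 0 := by
    by_contra! h
    refine hk (R.weight_injective (LinearMap.ext fun t => ?_))
    rw [h t]
    simp [weight]
  have hx' : x = (R.weight k t)⁻¹ • ⁅R.h t, x⁆ := by rw [hx t, inv_smul_smul₀ ht]
  rw [hx']
  exact R.derived.smul_mem _
    (LieSubmodule.lie_mem_lie (LieSubmodule.mem_top _) (LieSubmodule.mem_top _))

/-- The derived algebra is generated by the `e_i` and `f_i`. -/
theorem derived_le [DecidableEq ι] {S : LieSubalgebra K R.KacMoody} (he : ∀ i, R.e i ∈ S) (hf : ∀ i, R.f i ∈ S) :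
    R.derived ≤ S := by
  have heS {k w} (hw : IsWord R.e k w) : w ∈ S := by
    induction hw with
    | single i => exact he i
    | cons i k w _ ih => exact S.lie_mem (he i) ih
  have hfS {k w} (hw : IsWord R.f k w) : w ∈ S := by
    induction hw with
    | single i => exact hf i
    | cons i k w _ ih => exact S.lie_mem (hf i) ih
  have hG : ∀ z ∈ R.spanningSet, (z ∈ S ∧ ∀ t, ⁅R.h t, z⁆ ∈ S) ∨ z ∈ Set.range R.h := by
    rintro z ((⟨k, hw⟩ | ⟨k, hw⟩) | hz)
    · exact .inl ⟨heS hw, fun t => isWord_e_mem hw t ▸ S.smul_mem _ (heS hw)⟩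
    · exact .inl ⟨hfS hw, fun t => isWord_f_mem hw t ▸ S.smul_mem _ (hfS hw)⟩
    · exact .inr hz
  -- Cartan elements need not lie in $S$, but they only rescale words and commute with each other.
  have hlie : ∀ y ∈ R.spanningSet, ∀ z ∈ R.spanningSet, ⁅y, z⁆ ∈ S := by
    intro y hy z hz
    rcases hG y hy with ⟨hy, hy'⟩ | ⟨s, rfl⟩ <;> rcases hG z hz with ⟨hz, hz'⟩ | ⟨t, rfl⟩
    · exact S.lie_mem hy hz
    · rw [← lie_skew]
      exact neg_mem (hy' t)
    · exact hz' s
    · rw [lie_h_h]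
      exact S.zero_mem
  have hall (y z : R.KacMoody) : ⁅y, z⁆ ∈ S := by
    have hy : y ∈ Submodule.span K R.spanningSet := R.span_spanningSet ▸ Submodule.mem_top
    have hz : z ∈ Submodule.span K R.spanningSet := R.span_spanningSet ▸ Submodule.mem_top
    induction hy, hz using Submodule.span_induction₂ with
    | mem_mem y z hy hz => exact hlie y hy z hz
    | zero_left => simp
    | zero_right => simp
    | add_left => rw [add_lie]; exact add_mem ‹_› ‹_›
    | add_right => rw [lie_add]; exact add_mem ‹_› ‹_›
    | smul_left c => rw [smul_lie]; exact S.smul_mem c ‹_›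
    | smul_right c => rw [lie_smul]; exact S.smul_mem c ‹_›
  intro x hx
  have hx' : x ∈ (⁅(⊤ : LieIdeal K R.KacMoody), (⊤ : LieIdeal K R.KacMoody)⁆ :
      LieIdeal K R.KacMoody).toSubmodule := hx
  rw [LieSubmodule.lieIdeal_oper_eq_linear_span'] at hx'
  refine Submodule.span_le (p := S.toSubmodule).2 ?_ hx'
  rintro _ ⟨y, -, z, -, rfl⟩
  exact hall y z

end derived

/-! ### Descent from a real root to the simple roots -/

section E9

variable [CharZero K] {R : Realization K cartanE9 H}

/-- The norm of $k+\alpha_i$ exceeds $2$, so $e_i$ kills $x$; if $f_i$ did too, the coroot would act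
by zero. -/
theorem lie_f_ne_zero {k : Fin 9 → ℤ} {x : R.KacMoody} (hx : x ∈ R.rootSpace k) (hx0 : x ≠ 0)
    {i : Fin 9} (hk : 0 < (cartanE9 *ᵥ k) i) : ⁅R.f i, x⁆ ≠ 0 := by
  intro hf
  have he : ⁅R.e i, x⁆ = 0 := by
    refine eq_zero_of_two_lt_quadForm isSymm_cartanE9 cartanE9_diag ?_
      (lie_mem_rootSpace (R.e_mem_rootSpace i) hx)
    have := isSymm_cartanE9.quadForm_add_smul_single cartanE9_diag k 1 i
    rw [one_smul, add_comm k] at this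
    have := quadForm_cartanE9_nonneg k
    omega
  have h := R.lie_coroot hx i
  rw [← lie_e_f_same, lie_lie, hf, he, lie_zero, lie_zero, sub_zero] at h
  exact smul_ne_zero (Int.cast_ne_zero.2 hk.ne') hx0 h.symm

theorem lie_e_ne_zero {k : Fin 9 → ℤ} {x : R.KacMoody} (hx : x ∈ R.rootSpace k) (hx0 : x ≠ 0)
    {i : Fin 9} (hk : (cartanE9 *ᵥ k) i < 0) : ⁅R.e i, x⁆ ≠ 0 := by
  intro he
  have hf : ⁅R.f i, x⁆ = 0 := by
    refine eq_zero_of_two_lt_quadForm isSymm_cartanE9 cartanE9_diag ?_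
      (lie_mem_rootSpace (R.f_mem_rootSpace i) hx)
    have := isSymm_cartanE9.quadForm_sub_smul_single cartanE9_diag k 1 i
    rw [one_smul, sub_eq_add_neg, add_comm k] at this
    have := quadForm_cartanE9_nonneg k
    omega
  have h := R.lie_coroot hx i
  rw [← lie_e_f_same, lie_lie, hf, he, lie_zero, lie_zero, sub_zero] at h
  exact smul_ne_zero (Int.cast_ne_zero.2 hk.ne) hx0 h.symm

/-- The reflection of a root vector along a simple root. -/
theorem exists_reflection {k : Fin 9 → ℤ} {x : R.KacMoody} (hx : x ∈ R.rootSpace k) (hx0 : x ≠ 0)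
    {i : Fin 9} (hk : 0 < (cartanE9 *ᵥ k) i) :
    ∃ m : ℕ, (LieAlgebra.ad K R.KacMoody (R.f i) ^ m) x ∈
      R.rootSpace (k - (cartanE9 *ᵥ k) i • Pi.single i 1) ∧
      (LieAlgebra.ad K R.KacMoody (R.f i) ^ m) x ≠ 0 := by
  have hbot : R.rootSpace k ≠ ⊥ := (Submodule.ne_bot_iff _).2 ⟨x, hx, hx0⟩
  have t := R.isSl2Triple cartanE9_diag (R.coroot_ne_zero hbot hk.ne')
  have he : ⁅R.e i, x⁆ = 0 := by
    refine eq_zero_of_two_lt_quadForm isSymm_cartanE9 cartanE9_diag ?_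
      (lie_mem_rootSpace (R.e_mem_rootSpace i) hx)
    have := isSymm_cartanE9.quadForm_add_smul_single cartanE9_diag k 1 i
    rw [one_smul, add_comm k] at this
    have := quadForm_cartanE9_nonneg k
    omega
  obtain ⟨m, hm⟩ := Int.eq_ofNat_of_zero_le hk.le
  have hlie := R.lie_coroot hx i
  rw [hm] at hlie ⊢
  obtain ⟨p, hp⟩ := exists_f_pow_e_pow_ne_zero t hx0 (m := m) (by simpa using hlie)
    ⟨1, by simpa using he⟩
  -- Since $e_i$ kills $x$, the vector is already primitive and the string ends exactly at the
  -- reflection.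
  obtain rfl : p = 0 := by
    by_contra h
    obtain ⟨q, rfl⟩ := Nat.exists_eq_succ_of_ne_zero h
    rw [pow_succ (LieModule.toEnd K _ _ (R.e i)), Module.End.mul_apply,
      LieModule.toEnd_apply_apply, he, map_zero, map_zero] at hp
    exact hp rfl
  refine ⟨m, ?_, hp⟩
  have : k - (m : ℤ) • Pi.single i 1 = k + m • -Pi.single i 1 := by module
  rw [this]
  exact R.ad_pow_mem (R.f_mem_rootSpace i) hx m

/-- The vector `[f_8, [f_0, x]]` is nonzero for a root vector `x` of the root `α_0 + δ`. -/
theorem lie_f_lie_f_ne_zero {x : R.KacMoody} (hx : x ∈ R.rootSpace (Pi.single 0 1 + deltaE9))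
    (hx0 : x ≠ 0) : ⁅R.f 8, ⁅R.f 0, x⁆⁆ ≠ 0 := by
  have hw := lie_mem_rootSpace (R.e_mem_rootSpace 8) hx
  have hw0 : ⁅R.e 8, x⁆ ≠ 0 := lie_e_ne_zero hx hx0 (by decide)
  have hv := lie_mem_rootSpace (R.f_mem_rootSpace 0) hw
  have hv0 : ⁅R.f 0, ⁅R.e 8, x⁆⁆ ≠ 0 := lie_f_ne_zero hw hw0 (by decide)
  have hu0 : ⁅R.f 8, ⁅R.f 0, ⁅R.e 8, x⁆⁆⁆ ≠ 0 := lie_f_ne_zero hv hv0 (by decide)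
  -- $[f_0,x]$ has degree $\delta$, on which coroots vanish, so there $e_8$ and $f_8$ commute. If
  -- $f_8$ killed it, $f_8$ would also kill $[e_8,[f_0,x]]=[f_0,[e_8,x]]$, contradicting `hu0`.
  have h8 : ⁅R.h (R.coroot 8), ⁅R.f 0, x⁆⁆ = 0 := by
    rw [R.lie_coroot (lie_mem_rootSpace (R.f_mem_rootSpace 0) hx)]
    have : (cartanE9 *ᵥ (-Pi.single 0 1 + (Pi.single 0 1 + deltaE9))) 8 = 0 := by decide
    rw [this, Int.cast_zero, zero_smul]
  intro h
  apply hu0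
  have h1 : ⁅R.e 8, ⁅R.f 0, x⁆⁆ = ⁅R.f 0, ⁅R.e 8, x⁆⁆ := by
    rw [leibniz_lie, R.lie_e_f_ne (by decide), zero_lie, zero_add]
  rw [← h1]
  have h2 := leibniz_lie (R.e 8) (R.f 8) ⁅R.f 0, x⁆
  rwa [h, lie_zero, lie_e_f_same, h8, zero_add, eq_comm] at h2

/-- A submodule that is stable under the `f_j` contains `e_i` if it contains a root vector of a real
root with positive `i`-th coordinate. -/
theorem e_mem_of_rootVector_mem {S : Submodule K R.KacMoody} (hS : ∀ j, ∀ x ∈ S, ⁅R.f j, x⁆ ∈ S)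
    {k : Fin 9 → ℤ} (hk : cartanE9.quadForm k = 2) {i : Fin 9} (hki : 0 < k i) {x : R.KacMoody}
    (hxS : x ∈ S) (hx : x ∈ R.rootSpace k) (hx0 : x ≠ 0) : R.e i ∈ S := by
  induction hn : (∑ j, k j).toNat using Nat.strong_induction_on generalizing k x with
  | _ n ih =>
  have hnonneg {l : Fin 9 → ℤ} {y : R.KacMoody} (hy : y ∈ R.rootSpace l) (hy0 : y ≠ 0)
      (hl : 0 < l i) : 0 ≤ l :=
    (R.nonneg_or_nonpos ((Submodule.ne_bot_iff _).2 ⟨y, hy, hy0⟩)).resolve_right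
      fun h => absurd (h i) (not_le.2 hl)
  have hk0 := hnonneg hx hx0 hki
  have step (l : Fin 9 → ℤ) (y : R.KacMoody) (hyS : y ∈ S) (hy : y ∈ R.rootSpace l) (hy0 : y ≠ 0)
      (hl : cartanE9.quadForm l = 2) (hli : 0 < l i) (hlt : ∑ j, l j < ∑ j, k j) : R.e i ∈ S := by
    refine ih _ ?_ hl hli hyS hy hy0 rfl
    have : 0 ≤ ∑ j, l j := Finset.sum_nonneg fun j _ => hnonneg hy hy0 hli j
    omega
  have hfS (j : Fin 9) (m : ℕ) : (LieAlgebra.ad K R.KacMoody (R.f j) ^ m) x ∈ S := by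
    induction m with
    | zero => simpa using hxS
    | succ m ihm => rw [pow_succ', Module.End.mul_apply]; exact hS j _ ihm
  by_cases hj : ∃ j, 0 < (cartanE9 *ᵥ k) j ∧ 
      0 < (k - (cartanE9 *ᵥ k) j • Pi.single j 1 : Fin 9 → ℤ) i
  · obtain ⟨j, hj, hji⟩ := hj
    obtain ⟨m, hm, hm0⟩ := exists_reflection hx hx0 hj
    refine step _ _ (hfS j m) hm hm0 ?_ hji ?_
    · rw [isSymm_cartanE9.quadForm_sub_smul_single cartanE9_diag, hk]
      ring
    · simpa [Finset.sum_sub_distrib, ← Finset.mul_sum] using hj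
  · push Not at hj
    -- A reflection at $j\ne i$ does not change $k_i$, so it would have been allowed.
    have hle : ∀ j ≠ i, (cartanE9 *ᵥ k) j ≤ 0 := by
      intro j hji
      by_contra! h
      have := hj j h
      simp [hji.symm] at this
      omega
    have h2 : 2 ≤ k i * (cartanE9 *ᵥ k) i := by
      have hsum : ∑ j, k j * (cartanE9 *ᵥ k) j = 2 := hk
      rw [← Finset.add_sum_erase _ _ (Finset.mem_univ i)] at hsum
      have : ∑ j ∈ Finset.univ.erase i, k j * (cartanE9 *ᵥ k) j ≤ 0 :=
        Finset.sum_nonpos fun j hj =>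
          mul_nonpos_of_nonneg_of_nonpos (hk0 j) (hle j (Finset.ne_of_mem_erase hj))
      omega
    have hpos : 0 < (cartanE9 *ᵥ k) i := by nlinarith
    have hi := hj i hpos
    have hi2 := mulVec_cartanE9_le_two hk i
    simp at hi
    -- `hi` says $k_i\le(k,\alpha_i)$. A pairing of $1$ would give $k_i\le 1$, but `h2` would
    -- require $k_i\ge 2$.
    have hkm : (cartanE9 *ᵥ k) i = 2 := by
      by_contra h
      have h1 : (cartanE9 *ᵥ k) i = 1 := by omega
      rw [h1] at h2 hi
      omega
    obtain ⟨c, hc⟩ := eq_add_smul_deltaE9 hk hkm.ge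
    have hci := congrFun hc i
    simp at hci
    have hδ := deltaE9_pos i
    obtain rfl | hc1 : c = 0 ∨ 1 ≤ c := by
      by_contra! h
      have : c ≤ -1 := by omega
      nlinarith
    · rw [zero_smul, add_zero] at hc
      rw [hc, rootSpace_single, Submodule.mem_span_singleton] at hx
      obtain ⟨a, rfl⟩ := hx
      exact (Submodule.smul_mem_iff _ (left_ne_zero_of_smul hx0)).1 hxS
    -- $k_i=1+c\,\delta_i\le 2$ leaves only $c=\delta_i=1$, hence $i=0$ and $k=\alpha_0+\delta$.
    -- Reflecting at $0$ would give $\delta-\alpha_0$, with zeroth coefficient $0$; applying $f_0$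
    -- and then $f_8$ leads to the degree $\delta-\alpha_8$, of norm $2$ and zeroth coefficient $1$.
    · have hδ1 : deltaE9 i ≤ 1 := by nlinarith
      obtain rfl := eq_zero_of_deltaE9_le_one i hδ1
      obtain rfl : c = 1 := by nlinarith
      rw [one_smul] at hc
      subst hc
      exact step _ _ (hS 8 _ (hS 0 _ hxS))
        (lie_mem_rootSpace (R.f_mem_rootSpace 8) (lie_mem_rootSpace (R.f_mem_rootSpace 0) hx))
        (lie_f_lie_f_ne_zero hx hx0) (by decide) (by decide) (by decide)

theorem lieSpan_eq_derived {k : Fin 9 → ℤ} (hk : cartanE9.quadForm k = 2) (hk0 : ∀ i, 0 < k i)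
    {x : R.KacMoody} (hx : x ∈ R.rootSpace k) (hx0 : x ≠ 0) :
    LieSubalgebra.lieSpan K R.KacMoody (insert x (Set.range R.f)) = R.derived := by
  refine le_antisymm (LieSubalgebra.lieSpan_le.2 ?_) ?_
  · rintro _ (rfl | ⟨i, rfl⟩)
    · refine mem_derived_of_mem_rootSpace ?_ hx
      rintro rfl
      exact absurd (hk0 0) (lt_irrefl _)
    · exact mem_derived_of_mem_rootSpace (by simp) (R.f_mem_rootSpace i)
  · have hf (i : Fin 9) :
        R.f i ∈ LieSubalgebra.lieSpan K R.KacMoody (insert x (Set.range R.f)) :=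
      LieSubalgebra.subset_lieSpan (.inr ⟨i, rfl⟩)
    refine R.derived_le (fun i => ?_) hf
    exact e_mem_of_rootVector_mem (fun j y hy => LieSubalgebra.lie_mem _ (hf j) hy) hk (hk0 i)
      (LieSubalgebra.subset_lieSpan (.inl rfl)) hx hx0

end E9

end Realization

/-! ### The homomorphism and the main theorem -/

/-- Elements with vanishing double brackets define a homomorphism from the quantum minimal surface
algebra with zero spectrum. -/
theorem QMSA.exists_hom {K L : Type*} [CommRing K] [LieRing L] [LieAlgebra K L] {n : ℕ} (m : ℕ)
    (v : Fin n → L) (hv : ∀ i j, ⁅v i, ⁅v i, v j⁆⁆ = 0) :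
    ∃ φ : QMSA K n m 0 →ₗ⁅K⁆ L, ∀ j, φ (QMSA.gen K n m 0 j) = v j := by
  have hker : qmsaIdeal K n m 0 ≤ (FreeLieAlgebra.lift K v).ker := by
    refine LieSubmodule.lieSpan_le.2 ?_
    rintro _ ⟨j, rfl⟩
    simp [qmsaRelation, hv]
  refine ⟨{ (qmsaIdeal K n m 0).toSubmodule.liftQ
              (FreeLieAlgebra.lift K v : FreeLieAlgebra K (Fin n) →ₗ[K] L) hker with
            map_lie' := ?_ }, fun j => FreeLieAlgebra.lift_of_apply v j⟩
  intro x y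
  induction x using Submodule.Quotient.induction_on
  induction y using Submodule.Quotient.induction_on
  exact LieHom.map_lie (FreeLieAlgebra.lift K v) _ _

/-- A pairing of $2$ forces $\gamma=\alpha_i+c\delta$. Comparing coefficients gives $\beta=-\theta$
for $i=0$ and $\beta=\alpha_i$ otherwise. -/
theorem mulVec_cartanE9_le_one {n : ℤ} {β : Fin 8 → ℤ} {γ : Fin 9 → ℤ} (hβθ : β ≠ -thetaE8)
    (hβα : ∀ i : Fin 8, β ≠ Pi.single i 1) (hγ : γ = n • deltaE9 + embedE8 β)
    (hγ2 : cartanE9.quadForm γ = 2) (i : Fin 9) : (cartanE9 *ᵥ γ) i ≤ 1 := by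
  by_contra! h
  obtain ⟨c, hc⟩ := eq_add_smul_deltaE9 hγ2 h
  rw [hγ] at hc
  have h0 := congrFun hc 0
  have hs (j : Fin 8) := congrFun hc j.succ
  simp [deltaE9, embedE8] at h0 hs
  refine Fin.cases (fun h0 hs => hβθ ?_) (fun l h0 hs => hβα l ?_) i h0 hs
  · ext j
    have := hs j
    simp at h0 this ⊢
    subst h0
    linarith
  · ext j
    have := hs j
    simp [Pi.single_apply] at h0 this ⊢
    subst h0
    linarith

theorem mainTheorem5 {K : Type*} [RCLike K]
    {H₈ : Type*} [AddCommGroup H₈] [Module K H₈] (R₈ : Realization K CartanMatrix.E₈ H₈)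
    {H₉ : Type*} [AddCommGroup H₉] [Module K H₉] (R₉ : Realization K cartanE9 H₉)
    (n : ℤ) (β : Fin 8 → ℤ) (γ : Fin 9 → ℤ)
    (hβ : β ∈ R₈.roots) (hβθ : β ≠ -thetaE8) (hβα : ∀ i : Fin 8, β ≠ Pi.single i 1)
    (hγ : γ = n • deltaE9 + embedE8 β) (hγre : IsRealRoot cartanE9 γ)
    (e : R₉.KacMoody) (he : e ∈ R₉.rootSpace γ) (he0 : e ≠ 0) :
    -- the relevant weights are not roots
    (∀ i : Fin 9, 2 • γ - Pi.single i 1 ∉ R₉.roots ∧ γ - 2 • Pi.single i 1 ∉ R₉.roots) ∧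
    -- double brackets vanish
    (∀ y ∈ insert e (Set.range R₉.f), ∀ z ∈ insert e (Set.range R₉.f), ⁅y, ⁅y, z⁆⁆ = 0) ∧
    -- generation of the derived algebra, for a positive root of maximal support
    ((∀ i, 0 < γ i) →
      LieSubalgebra.lieSpan K R₉.KacMoody (insert e (Set.range R₉.f)) = R₉.derived) ∧
    -- the homomorphism, which is an epimorphism for a positive root of maximal support
    (∀ d : ℕ, d ≤ 10 → ∃ φ : QMSA K 10 d 0 →ₗ⁅K⁆ R₉.derived,
      (∀ i : Fin 9, (φ (QMSA.gen K 10 d 0 i.castSucc) : R₉.KacMoody) = R₉.f i) ∧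
      (φ (QMSA.gen K 10 d 0 (Fin.last 9)) : R₉.KacMoody) = e ∧
      ((∀ i, 0 < γ i) → Function.Surjective φ)) := by
  have hγ2 : cartanE9.quadForm γ = 2 :=
    isSymm_cartanE9.quadForm_of_isRealRoot cartanE9_diag hγre
  have hle := mulVec_cartanE9_le_one hβθ hβα hγ hγ2
  have hroot {k : Fin 9 → ℤ} (hk : 2 < cartanE9.quadForm k) : R₉.rootSpace k = ⊥ :=
    (Submodule.eq_bot_iff _).2 fun x hx =>
      Realization.eq_zero_of_two_lt_quadForm isSymm_cartanE9 cartanE9_diag hk hx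
  have h1 (i : Fin 9) : R₉.rootSpace (2 • γ - Pi.single i 1) = ⊥ := by
    refine hroot ?_
    have h := isSymm_cartanE9.quadForm_sub_smul_single cartanE9_diag ((2 : ℤ) • γ) 1 i
    rw [quadForm_smul, mulVec_smul, Pi.smul_apply, smul_eq_mul, one_smul, hγ2, ofNat_zsmul] at h
    have := hle i
    omega
  have h2 (i : Fin 9) : R₉.rootSpace (γ - 2 • Pi.single i 1) = ⊥ := by
    refine hroot ?_
    have h := isSymm_cartanE9.quadForm_sub_smul_single cartanE9_diag γ 2 i
    rw [hγ2, ofNat_zsmul] at h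
    have := hle i
    omega
  have hγ0 : γ ≠ 0 := by
    rintro rfl
    simp [quadForm] at hγ2
  have hlie : ∀ y ∈ insert e (Set.range R₉.f), ∀ z ∈ insert e (Set.range R₉.f),
      ⁅y, ⁅y, z⁆⁆ = 0 := by
    rintro _ (rfl | ⟨i, rfl⟩) _ (rfl | ⟨j, rfl⟩)
    · simp
    · refine (Submodule.eq_bot_iff _).1 (h1 j) _ ?_
      have h : 2 • γ - Pi.single j 1 = γ + (γ + -Pi.single j 1) := by module
      rw [h]
      exact Realization.lie_mem_rootSpace he
        (Realization.lie_mem_rootSpace he (R₉.f_mem_rootSpace j))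
    · refine (Submodule.eq_bot_iff _).1 (h2 i) _ ?_
      have h : γ - 2 • Pi.single i 1 = -Pi.single i 1 + (-Pi.single i 1 + γ) := by module
      rw [h]
      exact Realization.lie_mem_rootSpace (R₉.f_mem_rootSpace i)
        (Realization.lie_mem_rootSpace (R₉.f_mem_rootSpace i) he)
    · by_cases hij : i = j
      · simp [hij]
      · have hA : ∀ i j, i ≠ j → (1 - cartanE9 i j).toNat ≤ 2 := by decide
        simpa [pow_two] using Module.End.pow_map_zero_of_le (hA i j hij) (R₉.serre_f hij)
  have hspan (hpos : ∀ i, 0 < γ i) := Realization.lieSpan_eq_derived hγ2 hpos he he0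
  refine ⟨fun i => ⟨fun h => h.2 (h1 i), fun h => h.2 (h2 i)⟩, hlie, hspan, fun d _ => ?_⟩
  have hf' (i : Fin 9) : R₉.f i ∈ R₉.derived :=
    Realization.mem_derived_of_mem_rootSpace (by simp) (R₉.f_mem_rootSpace i)
  have he' : e ∈ R₉.derived := Realization.mem_derived_of_mem_rootSpace hγ0 he
  let v : Fin 10 → R₉.derived :=
    Fin.snoc (α := fun _ => R₉.derived) (fun i => ⟨R₉.f i, hf' i⟩) ⟨e, he'⟩
  have hvf (i : Fin 9) : v i.castSucc = ⟨R₉.f i, hf' i⟩ := Fin.snoc_castSucc ..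
  have hve : v (Fin.last 9) = ⟨e, he'⟩ := Fin.snoc_last ..
  have hv (j : Fin 10) : (v j : R₉.KacMoody) ∈ insert e (Set.range R₉.f) := by
    refine Fin.lastCases ?_ (fun i => ?_) j
    · exact .inl (by rw [hve])
    · exact .inr ⟨i, by rw [hvf]⟩
  obtain ⟨φ, hφ⟩ := QMSA.exists_hom (K := K) d v fun i j =>
    Subtype.ext (hlie _ (hv i) _ (hv j))
  have hφf (i : Fin 9) : (φ (QMSA.gen K 10 d 0 i.castSucc) : R₉.KacMoody) = R₉.f i := by
    rw [hφ, hvf]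
  have hφe : (φ (QMSA.gen K 10 d 0 (Fin.last 9)) : R₉.KacMoody) = e := by
    rw [hφ, hve]
  refine ⟨φ, hφf, hφe, fun hpos y => ?_⟩
  -- The image is a subalgebra containing the generators $e_\gamma,f_0,\dots,f_8$.
  have hle' : R₉.derived ≤ (R₉.derived.incl.comp φ).range := by
    refine (hspan hpos).ge.trans (LieSubalgebra.lieSpan_le.2 ?_)
    rintro _ (rfl | ⟨i, rfl⟩)
    · exact ⟨_, hφe⟩
    · exact ⟨_, hφf i⟩
  obtain ⟨x, hx⟩ := hle' y.2
  exact ⟨x, Subtype.ext hx⟩
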